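/- Let $P$ be a probability law of a pair $(x,y)$ on a product $\mathcal X\times\mathcal Y$ of standard Borel spaces (for instance $\mathcal X=\mathcal Y=\mathbb R$ with a Gaussian input and a Gaussian channel). Let $(x_1,y_1),\dots,(x_N,y_N)$ be independent pairs, each with law $P$ (the inputs, whose code is unknown to the relay, and the outputs over $N$ uses of a memoryless channel), and write $\mathbf x=(x_1,\dots,x_N)$, $\mathbf y=(y_1,\dots,y_N)$. Let $\mathbf b$ be the output of a relay that observes only $\mathbf y$, i.e. a random variable with values in a finite or countable set such that $\mathbf x-\mathbf y-\mathbf b$ is a Markov chain, and let its rate $C\in[0,\infty]$ be given by $H(\mathbf b)=N\cdot C$. Here $I$ and $H$ denote mutual information and Shannon entropy in nats, with values in $[0,\infty]$. Then there are random variables $x^*,y^*$ and a real-valued (scalar) random variable $z^*$ such that $(x^*,y^*)$ has law $P$, $x^*-y^*-z^*$ is a Markov chain, and $$N\cdot I(x^*;z^*)\ \ge\ I(\mathbf b;\mathbf x),\qquad N\cdot I(y^*;z^*)\ \le\ H(\mathbf b)=N\cdot C .$$ -/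

import Mathlib

open MeasureTheory ProbabilityTheory InformationTheory
open scoped ENNReal

/-- Mutual information `I(X; Y)` in nats, with values in `[0, ∞]`: the Kullback-Leibler divergence
of the joint law from the product of the marginal laws. -/
noncomputable def mutualInfo {Ω α β : Type*} [MeasurableSpace Ω] [MeasurableSpace α]
    [MeasurableSpace β] (X : Ω → α) (Y : Ω → β) (μ : Measure Ω) : ℝ≥0∞ :=
  klDiv (μ.map (fun ω => (X ω, Y ω))) ((μ.map X).prod (μ.map Y))

/-- Shannon entropy `H(B)` in nats, with values in `[0, ∞]`, of a random variable with values in a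
countable discrete space. -/
noncomputable def shannonEntropy {Ω β : Type*} [MeasurableSpace Ω] [MeasurableSpace β]
    [Countable β] [MeasurableSingletonClass β] (B : Ω → β) (μ : Measure Ω) : ℝ≥0∞ :=
  ∑' v : β, ENNReal.ofReal (Real.negMulLog ((μ.map B).real {v}))

/-- `X - Y - Z` is a Markov chain under `μ`: `X` and `Z` are conditionally independent given the
σ-algebra generated by `Y`. -/
def IsMarkovChain {Ω α β γ : Type*} [MeasurableSpace Ω] [StandardBorelSpace Ω]
    [MeasurableSpace α] [mβ : MeasurableSpace β] [MeasurableSpace γ]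
    (X : Ω → α) (Y : Ω → β) (Z : Ω → γ) (hY : Measurable Y)
    (μ : Measure Ω) [IsFiniteMeasure μ] : Prop :=
  CondIndepFun (mβ.comap Y) hY.comap_le X Z μ

/-! ### Data processing and the chain rule for mutual information. -/

section Divergence

variable {α β γ δ : Type*} [MeasurableSpace α] [MeasurableSpace β] [MeasurableSpace γ]
  [MeasurableSpace δ]

/-! Let `R` be the backward channel of `P`, from `y` to `x`. Independence of the pairs makes the
backward block channel a product of copies of `R`, and the Markov property says that the law of `(𝐱,
b)` is this channel applied to the first coordinate of the law of `(𝐲, b)`. So everything can be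
argued on the law of `(𝐲, b)`.

Peel off one letter: I(𝐲; z) = I(y₀; z) + I(y'; z, y₀), and likewise I(𝐱; z) = I(x₀; z) + I(x'; z,
x₀) (`jointInfo_prod_eq_add`). Since `x₀` is a degraded copy of `y₀`, data processing gives I(x'; z,
x₀) ≤ I(x'; z, y₀). Iterating with `(z, y₀)` as the new auxiliary variable yields letters zᵢ = (b,
y₀, …, yᵢ₋₁) with Σ I(xᵢ; zᵢ) ≥ I(𝐱; b) and Σ I(yᵢ; zᵢ) ≤ I(𝐲; b) ≤ H(b)
(`exists_block_kernel_and_letters`, `jointInfo_le_entropy`).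

Finally choose the letter index uniformly and reveal it in `z*`. All letters have the same input
law, so both sums become N times a single mutual information (`exists_timeSharing`). Each auxiliary
variable is standard Borel, hence embeds measurably in ℝ without changing information; this makes
`z*` scalar. Only addition in [0, ∞] is used, so infinite informations need no separate treatment.
-/

lemma klDiv_map_of_leftInverse {μ ν : Measure α} [IsFiniteMeasure μ] [IsFiniteMeasure ν]
    {f : α → β} {g : β → α} (hf : Measurable f) (hg : Measurable g)
    (hgf : Function.LeftInverse g f) :
    klDiv (μ.map f) (ν.map f) = klDiv μ ν := by
  refine le_antisymm (klDiv_map_le μ ν hf) ?_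
  have h := klDiv_map_le (μ.map f) (ν.map f) hg
  rwa [Measure.map_map hg hf, Measure.map_map hg hf, hgf.comp_eq_id, Measure.map_id,
    Measure.map_id] at h

/-- The mutual information of the two coordinates under a joint law. -/
noncomputable def jointInfo (T : Measure (α × β)) : ℝ≥0∞ := klDiv T (T.fst.prod T.snd)

lemma mutualInfo_eq_jointInfo {Ω : Type*} [MeasurableSpace Ω] {X : Ω → α} {Y : Ω → β}
    (hX : Measurable X) (hY : Measurable Y) (μ : Measure Ω) :
    mutualInfo X Y μ = jointInfo (μ.map fun ω => (X ω, Y ω)) := by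
  rw [mutualInfo, jointInfo, Measure.fst_map_prodMk hY, Measure.snd_map_prodMk hX]

lemma fst_parallelComp_comp (K : Kernel α γ) (L : Kernel β δ) [IsMarkovKernel K]
    [IsMarkovKernel L] (T : Measure (α × β)) :
    ((K ∥ₖ L) ∘ₘ T).fst = K ∘ₘ T.fst := by
  ext s hs
  rw [Measure.fst_apply hs, Measure.bind_apply (measurable_fst hs) (Kernel.aemeasurable _),
    Measure.bind_apply hs (Kernel.aemeasurable _), Measure.fst,
    lintegral_map (Kernel.measurable_coe _ hs) measurable_fst]
  congr with x
  rw [← Set.prod_univ, Kernel.parallelComp_apply_prod]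
  simp

lemma snd_parallelComp_comp (K : Kernel α γ) (L : Kernel β δ) [IsMarkovKernel K]
    [IsMarkovKernel L] (T : Measure (α × β)) :
    ((K ∥ₖ L) ∘ₘ T).snd = L ∘ₘ T.snd := by
  ext s hs
  rw [Measure.snd_apply hs, Measure.bind_apply (measurable_snd hs) (Kernel.aemeasurable _),
    Measure.bind_apply hs (Kernel.aemeasurable _), Measure.snd,
    lintegral_map (Kernel.measurable_coe _ hs) measurable_snd]
  congr with x
  rw [← Set.univ_prod, Kernel.parallelComp_apply_prod]
  simp

lemma parallelComp_comp_prod_measure (K : Kernel α γ) (L : Kernel β δ) [IsMarkovKernel K]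
    [IsMarkovKernel L] (μ : Measure α) (ν : Measure β) [IsFiniteMeasure μ] [IsFiniteMeasure ν] :
    (K ∥ₖ L) ∘ₘ (μ.prod ν) = (K ∘ₘ μ).prod (L ∘ₘ ν) := by
  refine (Measure.prod_eq fun s t hs ht => ?_).symm
  rw [Measure.bind_apply (hs.prod ht) (Kernel.aemeasurable _),
    Measure.bind_apply hs (Kernel.aemeasurable _), Measure.bind_apply ht (Kernel.aemeasurable _)]
  simp_rw [Kernel.parallelComp_apply_prod]
  exact lintegral_prod_mul (Kernel.measurable_coe _ hs).aemeasurable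
    (Kernel.measurable_coe _ ht).aemeasurable

/-- Data processing: local channels do not increase mutual information. -/
lemma jointInfo_parallelComp_comp_le (K : Kernel α γ) (L : Kernel β δ) [IsMarkovKernel K]
    [IsMarkovKernel L] (T : Measure (α × β)) [IsFiniteMeasure T] :
    jointInfo ((K ∥ₖ L) ∘ₘ T) ≤ jointInfo T := by
  rw [jointInfo, fst_parallelComp_comp, snd_parallelComp_comp, ← parallelComp_comp_prod_measure]
  exact klDiv_comp_right_le _ _ _

lemma map_prodMap_eq_parallelComp_comp {f : α → γ} {g : β → δ} (hf : Measurable f)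
    (hg : Measurable g) (T : Measure (α × β)) :
    T.map (Prod.map f g) = (Kernel.deterministic f hf ∥ₖ Kernel.deterministic g hg) ∘ₘ T := by
  rw [Kernel.deterministic_parallelComp_deterministic, Measure.deterministic_comp_eq_map]

lemma jointInfo_map_prodMap_le {f : α → γ} {g : β → δ} (hf : Measurable f)
    (hg : Measurable g) (T : Measure (α × β)) [IsFiniteMeasure T] :
    jointInfo (T.map (Prod.map f g)) ≤ jointInfo T := by
  rw [map_prodMap_eq_parallelComp_comp hf hg]
  exact jointInfo_parallelComp_comp_le _ _ T

lemma jointInfo_map_prodMap_of_leftInverse {f : α → γ} {g : β → δ} {f' : γ → α} {g' : δ → β}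
    (hf : Measurable f) (hg : Measurable g) (hf' : Measurable f') (hg' : Measurable g')
    (hff' : Function.LeftInverse f' f) (hgg' : Function.LeftInverse g' g)
    (T : Measure (α × β)) [IsFiniteMeasure T] :
    jointInfo (T.map (Prod.map f g)) = jointInfo T := by
  refine le_antisymm (jointInfo_map_prodMap_le hf hg T) ?_
  have h := jointInfo_map_prodMap_le hf' hg' (T.map (Prod.map f g))
  rwa [Measure.map_map (hf'.prodMap hg') (hf.prodMap hg), Prod.map_comp_map, hff'.comp_eq_id,
    hgg'.comp_eq_id, Prod.map_id, Measure.map_id] at h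

lemma jointInfo_map_id_embedding [Nonempty β] {g : β → δ} (hg : MeasurableEmbedding g)
    (T : Measure (α × β)) [IsFiniteMeasure T] :
    jointInfo (T.map (Prod.map id g)) = jointInfo T :=
  jointInfo_map_prodMap_of_leftInverse measurable_id hg.measurable measurable_id
    hg.measurable_invFun (fun _ => rfl) hg.leftInverse_invFun T

lemma jointInfo_map_swap (T : Measure (α × β)) [IsFiniteMeasure T] :
    jointInfo (T.map Prod.swap) = jointInfo T := by
  rw [jointInfo, Measure.fst_map_swap, Measure.snd_map_swap, ← Measure.prod_swap,
    klDiv_map_of_leftInverse measurable_swap measurable_swap Prod.swap_swap, jointInfo]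

lemma map_prodMap_parallelComp_comp {γ' δ' : Type*} [MeasurableSpace γ'] [MeasurableSpace δ']
    (K : Kernel α γ) (L : Kernel β δ) [IsMarkovKernel K] [IsMarkovKernel L]
    {f : γ → γ'} {g : δ → δ'} (hf : Measurable f) (hg : Measurable g) (T : Measure (α × β)) :
    ((K ∥ₖ L) ∘ₘ T).map (Prod.map f g) = ((K.map f) ∥ₖ (L.map g)) ∘ₘ T := by
  have := Kernel.IsMarkovKernel.map K hf
  have := Kernel.IsMarkovKernel.map L hg
  rw [Measure.map_comp _ _ (hf.prodMap hg)]
  congr 1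
  ext1 x
  rw [Kernel.map_apply _ (hf.prodMap hg), Kernel.parallelComp_apply, Kernel.parallelComp_apply,
    Kernel.map_apply _ hf, Kernel.map_apply _ hg, Measure.map_prod_map _ _ hf hg]

/-- Chain rule for the mutual information with a pair of independent variables. -/
lemma jointInfo_prod_eq_add [StandardBorelSpace β] [Nonempty β] (T : Measure ((α × β) × γ))
    [IsProbabilityMeasure T] (q₁ : Measure α) (q₂ : Measure β) [IsProbabilityMeasure q₁]
    [IsProbabilityMeasure q₂] (hT : T.fst = q₁.prod q₂) :
    jointInfo T = jointInfo (T.map fun w => (w.1.1, w.2)) +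
      jointInfo (T.map fun w => (w.1.2, (w.2, w.1.1))) := by
  set A : Measure (α × γ) := T.map fun w => (w.1.1, w.2) with hA
  have hmA : Measurable fun w : (α × β) × γ => (w.1.1, w.2) := by fun_prop
  have hme : Measurable fun w : (α × β) × γ => ((w.1.1, w.2), w.1.2) := by fun_prop
  have : IsProbabilityMeasure A := Measure.isProbabilityMeasure_map hmA.aemeasurable
  set K := condDistrib (fun w : (α × β) × γ => w.1.2) (fun w => (w.1.1, w.2)) T
  have hK : A ⊗ₘ K = T.map fun w => ((w.1.1, w.2), w.1.2) :=
    compProd_map_condDistrib (by fun_prop)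
  have hAfst : A.fst = q₁ := by
    rw [hA, Measure.fst_map_prodMk (by fun_prop), ← Function.comp_def,
      ← Measure.map_map measurable_fst measurable_fst]
    change T.fst.fst = _
    rw [hT, Measure.fst_prod]
  have hAsnd : A.snd = T.snd := by
    rw [hA, Measure.snd_map_prodMk (by fun_prop)]; rfl
  have hB1 : (T.map fun w => (w.1.2, (w.2, w.1.1))).fst = q₂ := by
    rw [Measure.fst_map_prodMk (by fun_prop), ← Function.comp_def,
      ← Measure.map_map measurable_snd measurable_fst]
    change T.fst.snd = _
    rw [hT, Measure.snd_prod]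
  have hB2 : (T.map fun w => (w.1.2, (w.2, w.1.1))).snd = A.map Prod.swap := by
    rw [Measure.snd_map_prodMk (by fun_prop), hA, Measure.map_map measurable_swap hmA]
    rfl
  -- With the second input moved last, the joint law disintegrates over `A` by `K`, while
  -- independence of the two inputs makes the reference measure a product with `q₂`. The chain rule
  -- for divergence then applies.
  have h1 : klDiv T (T.fst.prod T.snd) =
      klDiv (A ⊗ₘ K) ((A.fst.prod A.snd) ⊗ₘ Kernel.const _ q₂) := by
    rw [← klDiv_map_of_leftInverse (f := fun w : (α × β) × γ => ((w.1.1, w.2), w.1.2))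
      (g := fun w => ((w.1.1, w.2), w.1.2)) hme (by fun_prop) (fun _ => rfl), hK,
      hAfst, hAsnd, Measure.compProd_const, hT]
    congr 1
    refine Measure.ext_prod₃_iff'.2 fun {s t u} hs ht hu => ?_
    rw [Measure.map_apply hme ((hs.prod ht).prod hu), Measure.prod_prod, Measure.prod_prod]
    have : (fun w : (α × β) × γ => ((w.1.1, w.2), w.1.2)) ⁻¹' ((s ×ˢ t) ×ˢ u) =
        (s ×ˢ u) ×ˢ t := by ext; simp; tauto
    rw [this, Measure.prod_prod, Measure.prod_prod]
    ring
  have h2 : jointInfo (T.map fun w => (w.1.2, (w.2, w.1.1))) =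
      klDiv (A ⊗ₘ K) (A ⊗ₘ Kernel.const _ q₂) := by
    rw [jointInfo, hB1, hB2, hK, Measure.compProd_const,
      ← klDiv_map_of_leftInverse (f := fun w : β × (γ × α) => ((w.2.2, w.2.1), w.1))
      (g := fun w => (w.2, (w.1.2, w.1.1))) (by fun_prop) (by fun_prop) (fun _ => rfl),
      Measure.map_map (by fun_prop) (by fun_prop)]
    congr 1
    have : (fun w : β × (γ × α) => ((w.2.2, w.2.1), w.1)) =
      Prod.swap ∘ Prod.map id Prod.swap := rfl
    rw [this, ← Measure.map_map measurable_swap (measurable_id.prodMap measurable_swap),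
      ← Measure.map_prod_map _ _ measurable_id measurable_swap, Measure.map_id,
      Measure.map_map measurable_swap measurable_swap, Prod.swap_swap_eq, Measure.map_id,
      Measure.prod_swap]
  rw [h2, jointInfo, h1, klDiv_compProd_eq_add, jointInfo]

end Divergence

/-! ### Divergence over a countable index: entropy bound and mixtures. -/

section Countable

variable {ι α β γ : Type*} [MeasurableSpace ι] [Countable ι] [MeasurableSingletonClass ι]
  [MeasurableSpace α] [MeasurableSpace β] [MeasurableSpace γ]

/-- Conditional divergence over a countable base. -/
lemma klDiv_compProd_same_of_countable (p : Measure ι) [IsProbabilityMeasure p]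
    (κ η : Kernel ι α) [IsMarkovKernel κ] [IsMarkovKernel η] :
    klDiv (p ⊗ₘ κ) (p ⊗ₘ η) = ∑' i, p {i} * klDiv (κ i) (η i) := by
  by_cases hac : ∀ i, p {i} ≠ 0 → κ i ≪ η i
  · have h_ac : p ⊗ₘ κ ≪ p ⊗ₘ η := by
      refine Measure.AbsolutelyContinuous.compProd_right ?_
      rw [ae_iff_of_countable]
      exact hac
    set g := (p ⊗ₘ κ).rnDeriv (p ⊗ₘ η) with hg_def
    have hg : Measurable g := Measure.measurable_rnDeriv _ _
    have hgi (i : ι) : Measurable fun a => g (i, a) := hg.comp measurable_prodMk_left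
    -- On the fibre over an atom of positive mass, the slice of the joint density is the density of
    -- `κ i`, as the factor `p {i}` cancels.
    have hdens (i : ι) (hi : p {i} ≠ 0) : κ i = (η i).withDensity fun a => g (i, a) := by
      ext s hs
      have h1 : (p ⊗ₘ κ) ({i} ×ˢ s) = p {i} * κ i s := by
        rw [Measure.compProd_apply_prod (measurableSet_singleton i) hs, lintegral_singleton,
          mul_comm]
      have h2 : (p ⊗ₘ κ) ({i} ×ˢ s) = p {i} * (η i).withDensity (fun a => g (i, a)) s := by
        rw [← Measure.withDensity_rnDeriv_eq _ _ h_ac,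
          withDensity_apply _ ((measurableSet_singleton i).prod hs),
          Measure.setLIntegral_compProd hg (measurableSet_singleton i) hs, lintegral_singleton,
          withDensity_apply _ hs, mul_comm]
      exact (ENNReal.mul_right_inj hi (measure_ne_top _ _)).1 (h1.symm.trans h2)
    rw [klDiv_eq_lintegral_klFun_of_ac h_ac, Measure.lintegral_compProd (by fun_prop),
      lintegral_countable']
    refine tsum_congr fun i => ?_
    rcases eq_or_ne (p {i}) 0 with hi | hi
    · simp [hi]
    rw [klDiv_eq_lintegral_klFun_of_ac (hac i hi), mul_comm]
    congr 1
    refine lintegral_congr_ae ?_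
    have hrn : (κ i).rnDeriv (η i) =ᵐ[η i] fun a => g (i, a) := by
      conv_lhs => rw [hdens i hi]
      exact Measure.rnDeriv_withDensity _ (hgi i)
    filter_upwards [hrn] with a ha
    rw [ha]
  -- One singular fibre of positive mass makes both sides infinite.
  · push Not at hac
    obtain ⟨i, hi, hnac⟩ := hac
    have h_nac : ¬ p ⊗ₘ κ ≪ p ⊗ₘ η := by
      intro h
      refine hnac (Measure.AbsolutelyContinuous.mk fun s hs h0 => ?_)
      have h1 : (p ⊗ₘ η) ({i} ×ˢ s) = 0 := by
        rw [Measure.compProd_apply_prod (measurableSet_singleton i) hs, lintegral_singleton, h0,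
          zero_mul]
      have h2 := h h1
      rw [Measure.compProd_apply_prod (measurableSet_singleton i) hs, lintegral_singleton] at h2
      exact (mul_eq_zero.1 h2).resolve_right hi
    rw [klDiv_of_not_ac h_nac]
    refine (ENNReal.tsum_eq_top_of_eq_top ⟨i, ?_⟩).symm
    rw [klDiv_of_not_ac hnac, ENNReal.mul_top hi]

/-- The density of the point mass at `v` takes the value `1 / p {v}` there, and no other point is
charged. Averaged over `p`, these divergences give the entropy. -/
lemma klDiv_dirac (p : Measure ι) [IsProbabilityMeasure p] {v : ι} (hv : p {v} ≠ 0) :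
    klDiv (Measure.dirac v) p = ENNReal.ofReal (-Real.log (p.real {v})) := by
  have h_ac : Measure.dirac v ≪ p := by
    refine Measure.AbsolutelyContinuous.mk fun s hs h0 => ?_
    rw [Measure.dirac_apply' _ hs, Set.indicator_of_notMem]
    exact fun hvs => hv (measure_mono_null (Set.singleton_subset_iff.2 hvs) h0)
  have hg : ((Measure.dirac v).rnDeriv p v) * p {v} = 1 := by
    rw [← lintegral_singleton, Measure.setLIntegral_rnDeriv h_ac]
    simp
  have hint : Integrable (llr (Measure.dirac v) p) (Measure.dirac v) :=
    integrable_dirac (by simp)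
  rw [klDiv_of_ac_of_integrable h_ac hint, integral_dirac]
  congr 1
  have : ((Measure.dirac v).rnDeriv p v).toReal = (p.real {v})⁻¹ := by
    rw [ENNReal.eq_inv_of_mul_eq_one_left hg, ENNReal.toReal_inv]; rfl
  simp [llr, this]

/-- A countable-valued variable carries at most its Shannon entropy of information. -/
lemma jointInfo_le_entropy [StandardBorelSpace α] [Nonempty α] (T : Measure (α × ι))
    [IsProbabilityMeasure T] :
    jointInfo T ≤ ∑' v, ENNReal.ofReal (Real.negMulLog (T.snd.real {v})) := by
  set p := T.snd with hp
  set K := condDistrib (fun w : α × ι => w.1) (fun w => w.2) T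
  have hK : p ⊗ₘ K = T.map Prod.swap := compProd_map_condDistrib (by fun_prop)
  -- `T` is obtained from the law of a duplicated variable `(v, v)` by passing one copy through the
  -- channel `K`. Data processing then bounds its information by the self-information of `v`.
  have hT : (K ∥ₖ Kernel.id) ∘ₘ (p ⊗ₘ Kernel.id) = T := by
    have : T = (p ⊗ₘ K).map Prod.swap := by
      rw [hK, Measure.map_map measurable_swap measurable_swap, Prod.swap_swap_eq, Measure.map_id]
    rw [this]
    refine Measure.ext_prod fun {s t} hs ht => ?_
    rw [Measure.map_apply measurable_swap (hs.prod ht), Set.preimage_swap_prod,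
      Measure.compProd_apply_prod ht hs,
      Measure.bind_apply (hs.prod ht) (Kernel.aemeasurable _),
      Measure.lintegral_compProd (Kernel.measurable_coe _ (hs.prod ht)),
      ← lintegral_indicator ht]
    refine lintegral_congr fun v => ?_
    rw [Kernel.id_apply, lintegral_dirac, Kernel.parallelComp_apply_prod, Kernel.id_apply,
      Measure.dirac_apply' _ ht]
    by_cases hv : v ∈ t <;> simp [hv]
  calc jointInfo T ≤ jointInfo (p ⊗ₘ Kernel.id) := by
        conv_lhs => rw [← hT]
        exact jointInfo_parallelComp_comp_le _ _ _
    _ = ∑' v, p {v} * klDiv (Measure.dirac v) p := by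
        rw [jointInfo, Measure.fst_compProd, Measure.snd_compProd, Measure.id_comp,
          ← Measure.compProd_const, klDiv_compProd_same_of_countable]
        simp [Kernel.id_apply]
    _ = _ := by
        refine tsum_congr fun v => ?_
        -- At a null atom the divergence is multiplied by zero, and `0 * ∞ = 0`.
        rcases eq_or_ne (p {v}) 0 with hv | hv
        · simp [hv, Measure.real]
        rw [klDiv_dirac p hv, Real.negMulLog, neg_mul, ← mul_neg,
          ENNReal.ofReal_mul measureReal_nonneg, ofReal_measureReal]

/-- Time sharing: when the index of a mixture is revealed to the second coordinate and the first
coordinate is independent of it, mutual information averages. -/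
lemma jointInfo_mixture (p : Measure ι) [IsProbabilityMeasure p]
    (κ : Kernel ι (α × β)) [IsMarkovKernel κ] (q : Measure α) [IsProbabilityMeasure q]
    (hκ : ∀ i, (κ i).fst = q) :
    jointInfo ((p ⊗ₘ κ).map fun w => (w.2.1, (w.1, w.2.2))) =
      ∑' i, p {i} * jointInfo (κ i) := by
  have hm : Measurable fun w : ι × (α × β) => (w.2.1, (w.1, w.2.2)) := by fun_prop
  have hms : Measurable fun w : ι × (α × β) => (w.1, w.2.2) := by fun_prop
  set T := (p ⊗ₘ κ).map fun w => (w.2.1, (w.1, w.2.2)) with hT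
  -- The fibrewise product of marginals. Because the first marginal is `q` on every fibre, mixing
  -- `η` gives the product of the marginals of `T`.
  let η : Kernel ι (α × β) := (Kernel.const ι q) ×ₖ κ.snd
  have hη (i : ι) : η i = (κ i).fst.prod (κ i).snd := by
    rw [Kernel.prod_apply, Kernel.const_apply, Kernel.snd_apply, hκ, Measure.snd]
  have hfst : T.fst = q := by
    rw [hT, Measure.fst_map_prodMk hms, ← Function.comp_def,
      ← Measure.map_map measurable_fst measurable_snd]
    change (p ⊗ₘ κ).snd.map Prod.fst = q
    rw [Measure.snd_compProd, Measure.map_comp _ _ measurable_fst]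
    have : κ.map Prod.fst = Kernel.const ι q := by
      ext1 i
      rw [Kernel.map_apply _ measurable_fst, Kernel.const_apply, ← hκ i, Measure.fst]
    rw [this, Measure.const_comp, measure_univ, one_smul]
  have hsnd : T.snd = (p ⊗ₘ κ).map fun w => (w.1, w.2.2) := by
    rw [hT, Measure.snd_map_prodMk (by fun_prop)]
  have hprod : T.fst.prod T.snd = (p ⊗ₘ η).map fun w => (w.2.1, (w.1, w.2.2)) := by
    rw [hfst, hsnd]
    refine Measure.ext_prod₃ fun {s t u} hs ht hu => ?_
    have e1 : (fun w : ι × (α × β) => (w.2.1, (w.1, w.2.2))) ⁻¹' (s ×ˢ t ×ˢ u) =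
        t ×ˢ (s ×ˢ u) := by ext; simp; tauto
    have e2 : (fun w : ι × (α × β) => (w.1, w.2.2)) ⁻¹' (t ×ˢ u) =
        t ×ˢ (Set.univ ×ˢ u) := by ext; simp
    rw [Measure.prod_prod, Measure.map_apply hms (ht.prod hu),
      Measure.map_apply hm (hs.prod (ht.prod hu)), e1, e2,
      Measure.compProd_apply_prod ht (MeasurableSet.univ.prod hu),
      Measure.compProd_apply_prod ht (hs.prod hu), ← lintegral_const_mul _
        (Kernel.measurable_coe _ (MeasurableSet.univ.prod hu))]
    refine lintegral_congr fun i => ?_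
    rw [hη, Measure.prod_prod, hκ, Measure.snd_apply hu, ← Set.univ_prod]
  rw [jointInfo, hprod, hT, klDiv_map_of_leftInverse hm
    (g := fun w => (w.2.1, (w.1, w.2.2))) (by fun_prop) (fun _ => rfl),
    klDiv_compProd_same_of_countable]
  simp_rw [hη, jointInfo]

end Countable

/-- The channel acts inside each component and leaves the revealed index alone, so time sharing on
the `(y, z)` side is inherited by `(x, z)`. -/
lemma parallelComp_id_comp_mixture {ι α β γ : Type*} [MeasurableSpace ι] [MeasurableSpace α]
    [MeasurableSpace β] [MeasurableSpace γ] (p : Measure ι) [IsProbabilityMeasure p]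
    (κ : Kernel ι (α × β)) [IsMarkovKernel κ] (R : Kernel α γ) [IsMarkovKernel R] :
    (R ∥ₖ Kernel.id) ∘ₘ ((p ⊗ₘ κ).map fun w => (w.2.1, (w.1, w.2.2))) =
      (p ⊗ₘ ((R ∥ₖ Kernel.id) ∘ₖ κ)).map fun w => (w.2.1, (w.1, w.2.2)) := by
  have hm : Measurable fun w : ι × (α × β) => (w.2.1, (w.1, w.2.2)) := by fun_prop
  have hm' : Measurable fun w : ι × (γ × β) => (w.2.1, (w.1, w.2.2)) := by fun_prop
  have := Measure.isProbabilityMeasure_map (μ := p ⊗ₘ κ) hm.aemeasurable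
  refine Measure.ext_prod₃ fun {s t u} hs ht hu => ?_
  have hstu := hs.prod (ht.prod hu)
  have hk : Measurable fun w : ι × (α × β) =>
      (R ∥ₖ Kernel.id) (w.2.1, (w.1, w.2.2)) (s ×ˢ t ×ˢ u) := (Kernel.measurable_coe _ hstu).comp hm
  have e1 : (fun w : ι × (γ × β) => (w.2.1, (w.1, w.2.2))) ⁻¹' (s ×ˢ t ×ˢ u) =
      t ×ˢ (s ×ˢ u) := by ext; simp; tauto
  rw [Measure.bind_apply hstu (Kernel.aemeasurable _),
    lintegral_map (Kernel.measurable_coe _ hstu) hm,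
    Measure.lintegral_compProd hk, Measure.map_apply hm' hstu, e1, Measure.compProd_apply_prod ht (hs.prod hu),
    ← lintegral_indicator ht]
  refine lintegral_congr fun i => ?_
  by_cases hi : i ∈ t
  · rw [Set.indicator_of_mem hi, Kernel.comp_apply' _ _ _ (hs.prod hu)]
    refine lintegral_congr fun w => ?_
    rw [Kernel.parallelComp_apply_prod, Kernel.parallelComp_apply_prod, Kernel.id_apply,
      Kernel.id_apply, ← Measure.dirac_prod_dirac, Measure.prod_prod]
    simp [Measure.dirac_apply' _ ht, hi]
  · rw [Set.indicator_of_notMem hi, lintegral_eq_zero_of_ae_eq_zero]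
    refine Filter.Eventually.of_forall fun w => ?_
    simp only [Kernel.parallelComp_apply_prod, Kernel.id_apply]
    rw [← Measure.dirac_prod_dirac, Measure.prod_prod]
    simp [Measure.dirac_apply' _ ht, hi]

/-! ### Single-letter decomposition of block information. -/

section SingleLetter

variable {α β γ δ : Type*} [MeasurableSpace α] [MeasurableSpace β] [MeasurableSpace γ]
  [MeasurableSpace δ]

lemma comp_map_eq_comap_comp (T : Measure α) {f : α → β} (hf : Measurable f) (K : Kernel β γ) :
    K ∘ₘ (T.map f) = (K.comap f hf) ∘ₘ T := by
  rw [← Measure.deterministic_comp_eq_map hf, Measure.comp_assoc,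
    Kernel.comp_deterministic_eq_comap]

lemma jointInfo_of_subsingleton [Subsingleton α] (T : Measure (α × β)) [IsProbabilityMeasure T] :
    jointInfo T = 0 := by
  have h : T = T.fst.prod T.snd := by
    refine Measure.ext_prod fun {s t} hs ht => ?_
    rw [Measure.prod_prod]
    rcases Subsingleton.set_cases (p := fun s => s = ∅ ∨ s = Set.univ) (by simp) (by simp) s with
      rfl | rfl
    · simp
    · simp [Measure.snd_apply ht, Set.univ_prod]
  rw [jointInfo, ← h, klDiv_self]

/-- Allows the auxiliary variable to be re-encoded as a real before or after the channel acts on the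
other coordinate. -/
lemma parallelComp_id_comp_map_embedding (K : Kernel α γ) [IsMarkovKernel K] {g : β → δ}
    (hg : Measurable g) (T : Measure (α × β)) :
    (K ∥ₖ Kernel.id) ∘ₘ (T.map (Prod.map id g)) =
      ((K ∥ₖ Kernel.id) ∘ₘ T).map (Prod.map id g) := by
  rw [comp_map_eq_comap_comp _ (measurable_id.prodMap hg),
    Measure.map_comp _ _ (measurable_id.prodMap hg)]
  congr 1
  ext1 x
  rw [Kernel.comap_apply, Kernel.map_apply _ (measurable_id.prodMap hg),
    Kernel.parallelComp_apply, Kernel.parallelComp_apply,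
    ← Measure.map_prod_map _ _ measurable_id hg, Measure.map_id, Kernel.id_apply, Kernel.id_apply,
    Measure.map_dirac' hg]
  rfl

/-- Memorylessness for two blocks: by Tonelli, the first output and the second input may be drawn in
either order. -/
lemma prod_compProd_parallelComp (q : Measure α) (q' : Measure β) [IsProbabilityMeasure q]
    [IsProbabilityMeasure q'] (R : Kernel α γ) (R' : Kernel β δ) [IsMarkovKernel R]
    [IsMarkovKernel R'] :
    (q.prod q') ⊗ₘ (R ∥ₖ R') =
      ((q ⊗ₘ R).prod (q' ⊗ₘ R')).map (fun w => ((w.1.1, w.2.1), (w.1.2, w.2.2))) := by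
  refine Measure.ext_of_lintegral _ fun f hf => ?_
  rw [lintegral_map hf (by fun_prop), Measure.lintegral_compProd hf,
    lintegral_prod _ hf.lintegral_kernel_prod_right'.aemeasurable,
    lintegral_prod _ (by fun_prop),
    Measure.lintegral_compProd (by fun_prop)]
  refine lintegral_congr fun a => ?_
  simp_rw [Kernel.parallelComp_apply]
  have h1 (b : β) : ∫⁻ w, f ((a, b), w) ∂((R a).prod (R' b)) =
      ∫⁻ c, ∫⁻ d, f ((a, b), (c, d)) ∂(R' b) ∂(R a) := lintegral_prod _ (by fun_prop)
  have h2 (c : γ) : ∫⁻ w, f ((a, w.1), (c, w.2)) ∂(q' ⊗ₘ R') =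
      ∫⁻ b, ∫⁻ d, f ((a, b), (c, d)) ∂(R' b) ∂q' := Measure.lintegral_compProd (by fun_prop)
  simp_rw [h1, h2]
  refine lintegral_lintegral_swap (Measurable.aemeasurable ?_)
  have : Measurable fun w : (β × γ) × δ => f ((a, w.1.1), (w.1.2, w.2)) := by fun_prop
  exact this.lintegral_kernel_prod_right' (κ := R'.prodMkRight γ)

lemma map_parallelComp_fst_left (R : Kernel α γ) (R' : Kernel β δ) [IsMarkovKernel R]
    [IsMarkovKernel R'] {ζ : Type*} [MeasurableSpace ζ] (T : Measure ((α × β) × ζ)) :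
    (((R ∥ₖ R') ∥ₖ Kernel.id) ∘ₘ T).map (fun w => (w.1.1, w.2)) =
      (R ∥ₖ Kernel.id) ∘ₘ (T.map fun w => (w.1.1, w.2)) := by
  have hm : Measurable fun w : (γ × δ) × ζ => (w.1.1, w.2) := by fun_prop
  rw [comp_map_eq_comap_comp _ (by fun_prop), Measure.map_comp _ _ hm]
  congr 1
  ext1 x
  rw [Kernel.comap_apply, Kernel.map_apply _ hm, Kernel.parallelComp_apply,
    Kernel.parallelComp_apply, Kernel.parallelComp_apply]
  refine (Measure.prod_eq fun s t hs ht => ?_).symm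
  rw [Measure.map_apply hm (hs.prod ht)]
  have : (fun w : (γ × δ) × ζ => (w.1.1, w.2)) ⁻¹' (s ×ˢ t) = (s ×ˢ Set.univ) ×ˢ t := by
    ext; simp
  rw [this, Measure.prod_prod, Measure.prod_prod]
  simp [Kernel.id_apply]

/-- The inequality between `x` and `y` sides rests on this factorization: the second block is
transmitted while the first input is kept as side information, and only then is that input degraded
by `R`. Data processing removes the last stage. -/
lemma map_parallelComp_snd_left (R : Kernel α γ) (R' : Kernel β δ) [IsMarkovKernel R]
    [IsMarkovKernel R'] {ζ : Type*} [MeasurableSpace ζ] (T : Measure ((α × β) × ζ))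
    [IsFiniteMeasure T] :
    (((R ∥ₖ R') ∥ₖ Kernel.id) ∘ₘ T).map (fun w => (w.1.2, (w.2, w.1.1))) =
      (Kernel.id ∥ₖ ((Kernel.id : Kernel ζ ζ) ∥ₖ R)) ∘ₘ
        ((R' ∥ₖ (Kernel.id : Kernel (ζ × α) (ζ × α))) ∘ₘ (T.map fun w => (w.1.2, (w.2, w.1.1)))) := by
  have hm : Measurable fun w : (γ × δ) × ζ => (w.1.2, (w.2, w.1.1)) := by fun_prop
  rw [Measure.comp_assoc, Kernel.parallelComp_comp_parallelComp, Kernel.id_comp, Kernel.comp_id,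
    comp_map_eq_comap_comp _ (by fun_prop), Measure.map_comp _ _ hm]
  congr 1
  ext1 x
  rw [Kernel.comap_apply, Kernel.map_apply _ hm, Kernel.parallelComp_apply,
    Kernel.parallelComp_apply, Kernel.parallelComp_apply, Kernel.parallelComp_apply]
  have := Measure.isProbabilityMeasure_map
    (μ := (((R x.1.1).prod (R' x.1.2)).prod (Kernel.id x.2))) hm.aemeasurable
  refine Measure.ext_prod₃ fun {s t u} hs ht hu => ?_
  rw [Measure.map_apply hm (hs.prod (ht.prod hu))]
  have : (fun w : (γ × δ) × ζ => (w.1.2, (w.2, w.1.1))) ⁻¹' (s ×ˢ t ×ˢ u) =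
      (u ×ˢ s) ×ˢ t := by
    ext; simp; tauto
  rw [this, Measure.prod_prod, Measure.prod_prod, Measure.prod_prod, Measure.prod_prod]
  ring

/-- The block kernel of a memoryless backward channel, together with the decomposition of the
information carried by any function of the block into single-letter contributions. -/
theorem exists_block_kernel_and_letters [StandardBorelSpace α] [Nonempty α]
    [StandardBorelSpace β] [Nonempty β] (q : Measure α) [IsProbabilityMeasure q]
    (R : Kernel α β) [IsMarkovKernel R] (n : ℕ) :
    ∃ Rn : Kernel (Fin n → α) (Fin n → β), IsMarkovKernel Rn ∧
      (Measure.pi fun _ => q) ⊗ₘ Rn =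
        (Measure.pi fun _ => q ⊗ₘ R).map (fun w => (fun i => (w i).1, fun i => (w i).2)) ∧
      ∀ T : Measure ((Fin n → α) × ℝ), IsProbabilityMeasure T → T.fst = Measure.pi (fun _ => q) →
        ∃ S : Fin n → Measure (α × ℝ), (∀ i, IsProbabilityMeasure (S i)) ∧ (∀ i, (S i).fst = q) ∧
          jointInfo ((Rn ∥ₖ Kernel.id) ∘ₘ T) ≤ ∑ i, jointInfo ((R ∥ₖ Kernel.id) ∘ₘ S i) ∧
          ∑ i, jointInfo (S i) ≤ jointInfo T := by
  induction n with
  | zero =>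
    refine ⟨Kernel.const _ (Measure.dirac default), inferInstance, ?_, fun T hT _ => ?_⟩
    · have := Measure.isProbabilityMeasure_map (μ := Measure.pi fun _ : Fin 0 => q ⊗ₘ R)
        (f := fun w => ((fun i => (w i).1 : Fin 0 → α), (fun i => (w i).2 : Fin 0 → β)))
        (by fun_prop)
      ext s hs
      rcases Subsingleton.set_cases (p := fun s => s = ∅ ∨ s = Set.univ) (by simp) (by simp) s with
        rfl | rfl
      · simp
      · simp
    · refine ⟨fun i => i.elim0, fun i => i.elim0, fun i => i.elim0, ?_, by simp⟩
      rw [jointInfo_of_subsingleton]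
      exact zero_le
  | succ n ih =>
    obtain ⟨Rn, hRn, hlaw, hS⟩ := ih
    let eα := MeasurableEquiv.piFinSuccAbove (fun _ : Fin (n + 1) => α) 0
    let eβ := MeasurableEquiv.piFinSuccAbove (fun _ : Fin (n + 1) => β) 0
    have hq : (Measure.pi fun _ : Fin (n + 1) => q) =
        (q.prod (Measure.pi fun _ : Fin n => q)).map eα.symm :=
      ((measurePreserving_piFinSuccAbove (fun _ : Fin (n + 1) => q) 0).symm).map_eq.symm
    have hq' : (Measure.pi fun _ : Fin (n + 1) => q).map eα =
        q.prod (Measure.pi fun _ : Fin n => q) :=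
      (measurePreserving_piFinSuccAbove (fun _ : Fin (n + 1) => q) 0).map_eq
    have hqR : (Measure.pi fun _ : Fin (n + 1) => q ⊗ₘ R) =
        ((q ⊗ₘ R).prod (Measure.pi fun _ : Fin n => q ⊗ₘ R)).map
          (MeasurableEquiv.piFinSuccAbove (fun _ : Fin (n + 1) => α × β) 0).symm :=
      ((measurePreserving_piFinSuccAbove (fun _ : Fin (n + 1) => q ⊗ₘ R) 0).symm).map_eq.symm
    -- The head letter goes through `R` and the remaining block through `Rn`.
    let R' : Kernel (Fin (n + 1) → α) (Fin (n + 1) → β) :=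
      ((R ∥ₖ Rn).map eβ.symm).comap eα eα.measurable
    have hR'map : IsMarkovKernel ((R ∥ₖ Rn).map eβ.symm) :=
      Kernel.IsMarkovKernel.map _ eβ.symm.measurable
    have hR' : IsMarkovKernel R' := Kernel.IsMarkovKernel.comap _ eα.measurable
    refine ⟨R', hR', ?_, fun T hT hTfst => ?_⟩
    · have h1 : (Measure.pi fun _ : Fin (n + 1) => q) ⊗ₘ R' =
          ((q.prod (Measure.pi fun _ : Fin n => q)) ⊗ₘ (R ∥ₖ Rn)).map
            (Prod.map eα.symm eβ.symm) := by
        refine Measure.ext_prod fun {s t} hs ht => ?_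
        rw [Measure.map_apply (eα.symm.measurable.prodMap eβ.symm.measurable) (hs.prod ht),
          Set.preimage_prod_map_prod, Measure.compProd_apply_prod hs ht,
          Measure.compProd_apply_prod (eα.symm.measurable hs) (eβ.symm.measurable ht), hq,
          setLIntegral_map hs (Kernel.measurable_coe _ ht) eα.symm.measurable]
        refine lintegral_congr fun a => ?_
        rw [Kernel.comap_apply, Kernel.map_apply' _ eβ.symm.measurable _ ht,
          MeasurableEquiv.apply_symm_apply]
      rw [h1, prod_compProd_parallelComp, hlaw, hqR]
      have h2 : (q ⊗ₘ R).prod ((Measure.pi fun _ : Fin n => q ⊗ₘ R).map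
          (fun w => ((fun i => (w i).1 : Fin n → α), (fun i => (w i).2 : Fin n → β)))) =
          ((q ⊗ₘ R).prod (Measure.pi fun _ : Fin n => q ⊗ₘ R)).map (Prod.map id
            (fun w => ((fun i => (w i).1 : Fin n → α), (fun i => (w i).2 : Fin n → β)))) := by
        rw [← Measure.map_prod_map _ _ measurable_id (by fun_prop), Measure.map_id]
      rw [h2, Measure.map_map (by fun_prop) (by fun_prop),
        Measure.map_map ((eα.symm.measurable.prodMap eβ.symm.measurable).comp (by fun_prop))
          (by fun_prop),
        Measure.map_map (by fun_prop) (MeasurableEquiv.measurable _)]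
      congr 1
      funext w
      refine Prod.ext ?_ ?_ <;> funext i <;> refine Fin.cases ?_ (fun j => ?_) i <;>
        simp [eα, eβ, MeasurableEquiv.piFinSuccAbove]
    · set T' := T.map (Prod.map eα id) with hT'
      have hmα : Measurable (Prod.map eα (id : ℝ → ℝ)) := eα.measurable.prodMap measurable_id
      have hT'p : IsProbabilityMeasure T' := Measure.isProbabilityMeasure_map hmα.aemeasurable
      have hT'fst : T'.fst = q.prod (Measure.pi fun _ : Fin n => q) := by
        rw [← hq', ← hTfst, hT', Measure.fst, Measure.fst, Measure.map_map measurable_fst hmα,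
          Measure.map_map eα.measurable measurable_fst]
        rfl
      have hJT : jointInfo T' = jointInfo T :=
        jointInfo_map_prodMap_of_leftInverse eα.measurable measurable_id eα.symm.measurable
          measurable_id eα.symm_apply_apply (fun _ => rfl) T
      set A := T'.map fun w => (w.1.1, w.2) with hA
      set B := T'.map fun w => (w.1.2, (w.2, w.1.1)) with hB
      have hAp : IsProbabilityMeasure A := Measure.isProbabilityMeasure_map (by fun_prop)
      have hBp : IsProbabilityMeasure B := Measure.isProbabilityMeasure_map (by fun_prop)
      have hAfst : A.fst = q := by
        rw [hA, Measure.fst_map_prodMk (by fun_prop), ← Function.comp_def,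
          ← Measure.map_map measurable_fst measurable_fst]
        change T'.fst.fst = _
        rw [hT'fst, Measure.fst_prod]
      have hBfst : B.fst = Measure.pi fun _ : Fin n => q := by
        rw [hB, Measure.fst_map_prodMk (by fun_prop), ← Function.comp_def,
          ← Measure.map_map measurable_snd measurable_fst]
        change T'.fst.snd = _
        rw [hT'fst, Measure.snd_prod]
      -- The tail has auxiliary variable (old auxiliary, head letter); coding this pair as one real
      -- makes the inductive hypothesis applicable.
      have hemb := measurableEmbedding_embeddingReal (ℝ × α)
      have hmemb : Measurable (Prod.map (id : (Fin n → α) → (Fin n → α)) (embeddingReal (ℝ × α))) :=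
        measurable_id.prodMap hemb.measurable
      obtain ⟨S, hSp, hSfst, hSβ, hSα⟩ := hS (B.map (Prod.map id (embeddingReal (ℝ × α))))
        (Measure.isProbabilityMeasure_map hmemb.aemeasurable) (by
          rw [← hBfst, Measure.fst, Measure.map_map measurable_fst hmemb]; rfl)
      rw [parallelComp_id_comp_map_embedding _ hemb.measurable,
        jointInfo_map_id_embedding hemb] at hSβ
      rw [jointInfo_map_id_embedding hemb] at hSα
      refine ⟨Fin.cons A S, Fin.cases hAp hSp, Fin.cases hAfst hSfst, ?_, ?_⟩
      · have hU : ((R' ∥ₖ Kernel.id) ∘ₘ T).map (Prod.map eβ id) =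
            ((R ∥ₖ Rn) ∥ₖ Kernel.id) ∘ₘ T' := by
          rw [map_prodMap_parallelComp_comp _ _ eβ.measurable measurable_id, Kernel.map_id, hT',
            comp_map_eq_comap_comp _ hmα]
          congr 1
          have := Kernel.IsMarkovKernel.map R' eβ.measurable
          ext1 x
          rw [Kernel.comap_apply, Kernel.parallelComp_apply, Kernel.parallelComp_apply,
            Kernel.map_apply _ eβ.measurable, Kernel.comap_apply,
            Kernel.map_apply _ eβ.symm.measurable,
            Measure.map_map eβ.measurable eβ.symm.measurable, MeasurableEquiv.self_comp_symm,
            Measure.map_id]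
          rfl
        rw [← jointInfo_map_prodMap_of_leftInverse eβ.measurable measurable_id eβ.symm.measurable
          measurable_id eβ.symm_apply_apply (fun _ => rfl), hU,
          jointInfo_prod_eq_add _ (R ∘ₘ q) (Rn ∘ₘ (Measure.pi fun _ : Fin n => q)) (by
            rw [fst_parallelComp_comp, hT'fst, parallelComp_comp_prod_measure]),
          map_parallelComp_fst_left, map_parallelComp_snd_left, Fin.sum_univ_succ]
        -- The head terms agree; in the tail term, replacing the head output by the head input in
        -- the side information can only increase information.
        exact add_le_add le_rfl ((jointInfo_parallelComp_comp_le _ _ _).trans hSβ)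
      · rw [← hJT, jointInfo_prod_eq_add T' q _ hT'fst, Fin.sum_univ_succ]
        exact add_le_add le_rfl hSα

end SingleLetter

/-! ### Time sharing and the law of the test channel. -/

section TestChannel

variable {α β γ : Type*} [MeasurableSpace α] [MeasurableSpace β] [MeasurableSpace γ]

/-- When the output is generated from the input alone, ignoring the auxiliary variable, the pair
(output, auxiliary) arises by a local channel. This translates Markov chains into the form needed
for data processing. -/
lemma map_compProd_prodMkRight (T : Measure (α × γ)) [IsProbabilityMeasure T] (K : Kernel α β)
    [IsMarkovKernel K] :
    (T ⊗ₘ K.prodMkRight γ).map (fun w => (w.2, w.1.2)) = (K ∥ₖ Kernel.id) ∘ₘ T := by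
  have hm : Measurable fun w : (α × γ) × β => (w.2, w.1.2) := by fun_prop
  have := Measure.isProbabilityMeasure_map (μ := T ⊗ₘ K.prodMkRight γ) hm.aemeasurable
  refine Measure.ext_prod fun {s t} hs ht => ?_
  have e : (fun w : (α × γ) × β => (w.2, w.1.2)) ⁻¹' (s ×ˢ t) = (Prod.snd ⁻¹' t) ×ˢ s := by
    ext; simp; tauto
  rw [Measure.map_apply hm (hs.prod ht), e, Measure.compProd_apply_prod (measurable_snd ht) hs,
    Measure.bind_apply (hs.prod ht) (Kernel.aemeasurable _), ← lintegral_indicator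
      (measurable_snd ht)]
  refine lintegral_congr fun w => ?_
  rw [Kernel.parallelComp_apply_prod, Kernel.id_apply, Measure.dirac_apply' _ ht]
  by_cases h : w.2 ∈ t <;> simp [h]

lemma map_compProd_prodMkRight_fst (T : Measure (α × γ)) [IsProbabilityMeasure T]
    (K : Kernel α β) [IsMarkovKernel K] :
    (T ⊗ₘ K.prodMkRight γ).map (fun w => (w.1.1, w.2)) = T.fst ⊗ₘ K := by
  have hm : Measurable fun w : (α × γ) × β => (w.1.1, w.2) := by fun_prop
  have := Measure.isProbabilityMeasure_map (μ := T ⊗ₘ K.prodMkRight γ) hm.aemeasurable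
  refine Measure.ext_prod fun {s t} hs ht => ?_
  have e : (fun w : (α × γ) × β => (w.1.1, w.2)) ⁻¹' (s ×ˢ t) = (Prod.fst ⁻¹' s) ×ˢ t := by
    ext; simp
  rw [Measure.map_apply hm (hs.prod ht), e, Measure.compProd_apply_prod (measurable_fst hs) ht,
    Measure.compProd_apply_prod hs ht, Measure.fst,
    setLIntegral_map hs (Kernel.measurable_coe _ ht) measurable_fst]
  rfl

/-- Time sharing over a finite nonempty family of test channels with a common input law. -/
lemma exists_timeSharing {n : ℕ} (hn : n ≠ 0) (q : Measure α) [IsProbabilityMeasure q]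
    (R : Kernel α β) [IsMarkovKernel R] (S : Fin n → Measure (α × ℝ))
    [∀ i, IsProbabilityMeasure (S i)] (hS : ∀ i, (S i).fst = q) :
    ∃ S' : Measure (α × ℝ), IsProbabilityMeasure S' ∧ S'.fst = q ∧
      n * jointInfo S' = ∑ i, jointInfo (S i) ∧
      n * jointInfo ((R ∥ₖ Kernel.id) ∘ₘ S') = ∑ i, jointInfo ((R ∥ₖ Kernel.id) ∘ₘ S i) := by
  have : Nonempty (Fin n) := ⟨⟨0, Nat.pos_of_ne_zero hn⟩⟩
  let p : Measure (Fin n) := uniformOn Set.univ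
  have hp : IsProbabilityMeasure p :=
    isProbabilityMeasure_uniformOn Set.finite_univ Set.univ_nonempty
  have hpi (i : Fin n) : p {i} = (n : ℝ≥0∞)⁻¹ := by
    simp [p, uniformOn_univ]
  have hn' : (n : ℝ≥0∞) * (n : ℝ≥0∞)⁻¹ = 1 :=
    ENNReal.mul_inv_cancel (by exact_mod_cast hn) (ENNReal.natCast_ne_top n)
  have havg (f : Fin n → ℝ≥0∞) : n * ∑' i, p {i} * f i = ∑ i, f i := by
    rw [tsum_fintype, Finset.mul_sum]
    refine Finset.sum_congr rfl fun i _ => ?_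
    rw [hpi, ← mul_assoc, hn', one_mul]
  let κ : Kernel (Fin n) (α × ℝ) := ⟨S, measurable_of_countable S⟩
  have hκ : IsMarkovKernel κ := ⟨fun i => inferInstanceAs (IsProbabilityMeasure (S i))⟩
  have hm : Measurable fun w : Fin n × (α × ℝ) => (w.2.1, (w.1, w.2.2)) := by fun_prop
  set T := (p ⊗ₘ κ).map fun w => (w.2.1, (w.1, w.2.2)) with hT
  have hTp : IsProbabilityMeasure T := Measure.isProbabilityMeasure_map hm.aemeasurable
  have hTfst : T.fst = q := by
    ext s hs
    have e : (fun w : Fin n × (α × ℝ) => (w.2.1, (w.1, w.2.2))) ⁻¹' (Prod.fst ⁻¹' s) =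
        Set.univ ×ˢ (Prod.fst ⁻¹' s) := by ext; simp
    have hκs (i : Fin n) : κ i (Prod.fst ⁻¹' s) = q s := by
      rw [← hS i, Measure.fst_apply hs]; rfl
    rw [Measure.fst_apply hs, hT, Measure.map_apply hm (measurable_fst hs), e,
      Measure.compProd_apply_prod MeasurableSet.univ (measurable_fst hs)]
    simp [hκs]
  have hemb := measurableEmbedding_embeddingReal (Fin n × ℝ)
  have hme : Measurable (Prod.map (id : α → α) (embeddingReal (Fin n × ℝ))) :=
    measurable_id.prodMap hemb.measurable
  -- The new scalar auxiliary variable encodes both the random index and the auxiliary of the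
  -- selected letter.
  refine ⟨T.map (Prod.map id (embeddingReal (Fin n × ℝ))),
    Measure.isProbabilityMeasure_map hme.aemeasurable, ?_, ?_, ?_⟩
  · rw [← hTfst, Measure.fst, Measure.map_map measurable_fst hme]; rfl
  · rw [jointInfo_map_id_embedding hemb, hT, jointInfo_mixture p κ q hS, havg]
    rfl
  · rw [parallelComp_id_comp_map_embedding _ hemb.measurable, jointInfo_map_id_embedding hemb, hT,
      parallelComp_id_comp_mixture, jointInfo_mixture p _ (R ∘ₘ q), havg]
    · simp_rw [Kernel.comp_apply]
      rfl
    · intro i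
      rw [Kernel.comp_apply, fst_parallelComp_comp]
      congr 1
      exact hS i

end TestChannel

/-! ### Assembly: from the relay to the scalar test channel. -/

theorem theorem1 {Ω 𝒳 𝒴 𝓑 : Type*}
    [MeasurableSpace Ω] [StandardBorelSpace Ω] (μ : Measure Ω) [IsProbabilityMeasure μ]
    [MeasurableSpace 𝒳] [StandardBorelSpace 𝒳] [MeasurableSpace 𝒴] [StandardBorelSpace 𝒴]
    [MeasurableSpace 𝓑] [Countable 𝓑] [MeasurableSingletonClass 𝓑]
    (P : Measure (𝒳 × 𝒴)) [IsProbabilityMeasure P]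
    (N : ℕ) (C : ℝ≥0∞)
    (x : Fin N → Ω → 𝒳) (y : Fin N → Ω → 𝒴) (b : Ω → 𝓑)
    (hx : ∀ i, Measurable (x i)) (hy : ∀ i, Measurable (y i)) (hb : Measurable b)
    (hindep : iIndepFun (fun (i : Fin N) (ω : Ω) => (x i ω, y i ω)) μ)
    (hlaw : ∀ i, μ.map (fun ω => (x i ω, y i ω)) = P)
    (hmarkov : IsMarkovChain (fun ω i => x i ω) (fun ω i => y i ω) b
      (measurable_pi_lambda (fun ω i => y i ω) hy) μ)
    (hC : shannonEntropy b μ = N * C) :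
    ∃ (ν : Measure (𝒳 × 𝒴 × ℝ)) (_ : IsProbabilityMeasure ν),
      ν.map (fun ω => (ω.1, ω.2.1)) = P ∧
      IsMarkovChain (fun ω : 𝒳 × 𝒴 × ℝ => ω.1) (fun ω => ω.2.1) (fun ω => ω.2.2)
        (measurable_fst.comp measurable_snd) ν ∧
      mutualInfo b (fun ω i => x i ω) μ ≤
        N * mutualInfo (fun ω : 𝒳 × 𝒴 × ℝ => ω.1) (fun ω => ω.2.2) ν ∧
      N * mutualInfo (fun ω : 𝒳 × 𝒴 × ℝ => ω.2.1) (fun ω => ω.2.2) ν ≤ N * C := by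
  obtain ⟨x₀, y₀⟩ := P.nonempty_of_neZero.some
  have : Nonempty 𝒳 := ⟨x₀⟩
  have : Nonempty 𝒴 := ⟨y₀⟩
  have : Nonempty 𝓑 := ⟨b μ.nonempty_of_neZero.some⟩
  set q := P.snd
  set R : Kernel 𝒴 𝒳 := condDistrib (fun w : 𝒳 × 𝒴 => w.1) (fun w => w.2) P
  have hqR : q ⊗ₘ R = P.map Prod.swap := compProd_map_condDistrib (by fun_prop)
  obtain ⟨Rn, hRn, hRnlaw, hsplit⟩ := exists_block_kernel_and_letters q R N
  have hX : Measurable fun ω i => x i ω := measurable_pi_lambda _ hx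
  have hY : Measurable fun ω i => y i ω := measurable_pi_lambda _ hy
  have hblock : μ.map (fun ω => ((fun i => y i ω), (fun i => x i ω))) =
      (Measure.pi fun _ => q) ⊗ₘ Rn := by
    have h := (iIndepFun_iff_map_fun_eq_pi_map
      (fun i => ((hy i).prodMk (hx i)).aemeasurable)).1
      (hindep.comp (fun _ => Prod.swap) fun _ => measurable_swap)
    have h' (i : Fin N) : μ.map (fun ω => (y i ω, x i ω)) = q ⊗ₘ R := by
      rw [hqR, ← hlaw i, Measure.map_map measurable_swap ((hx i).prodMk (hy i))]; rfl
    simp only [h'] at h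
    rw [hRnlaw, ← h, Measure.map_map (by fun_prop)
      (measurable_pi_lambda _ fun i => (hy i).prodMk (hx i))]
    rfl
  have hYlaw : μ.map (fun ω i => y i ω) = Measure.pi fun _ => q := by
    rw [← Measure.fst_map_prodMk hX, hblock, Measure.fst_compProd]
  set T := μ.map fun ω => ((fun i => y i ω), b ω) with hT
  have hTp : IsProbabilityMeasure T := Measure.isProbabilityMeasure_map (hY.prodMk hb).aemeasurable
  have hTfst : T.fst = Measure.pi fun _ => q := by rw [hT, Measure.fst_map_prodMk hb, hYlaw]
  have hcond : condDistrib (fun ω i => x i ω) (fun ω i => y i ω) μ =ᵐ[T.fst] Rn := by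
    rw [hTfst, ← hYlaw]
    refine condDistrib_ae_eq_of_measure_eq_compProd _ hX.aemeasurable ?_
    rw [hblock, hYlaw]
  -- By the Markov property, conditioning `𝐱` on `(𝐲, b)` is the same as conditioning on `𝐲`, and
  -- that conditional law is `Rn`.
  have hXB : μ.map (fun ω => ((fun i => x i ω), b ω)) = (Rn ∥ₖ Kernel.id) ∘ₘ T := by
    have h1 := (condIndepFun_iff_condDistrib_prod_ae_eq_prodMkRight hX hb hY).1
      (CondIndepFun.symm hmarkov)
    have h2 : (condDistrib (fun ω i => x i ω) (fun ω i => y i ω) μ).prodMkRight 𝓑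
        =ᵐ[T] Rn.prodMkRight 𝓑 :=
      ae_of_ae_map measurable_fst.aemeasurable hcond
    have h3 := (condDistrib_ae_eq_iff_measure_eq_compProd _ hX.aemeasurable _).1 (h1.trans h2)
    rw [← map_compProd_prodMkRight, hT, ← h3, Measure.map_map (by fun_prop) (by fun_prop)]
    rfl
  have hemb := measurableEmbedding_embeddingReal 𝓑
  have hme : Measurable (Prod.map (id : (Fin N → 𝒴) → (Fin N → 𝒴)) (embeddingReal 𝓑)) :=
    measurable_id.prodMap hemb.measurable
  obtain ⟨S, hSp, hSfst, hSx, hSy⟩ := hsplit (T.map (Prod.map id (embeddingReal 𝓑)))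
    (Measure.isProbabilityMeasure_map hme.aemeasurable) (by
      rw [← hTfst, Measure.fst, Measure.map_map measurable_fst hme]; rfl)
  rw [parallelComp_id_comp_map_embedding _ hemb.measurable, jointInfo_map_id_embedding hemb,
    ← hXB] at hSx
  rw [jointInfo_map_id_embedding hemb] at hSy
  have hbx : mutualInfo b (fun ω i => x i ω) μ =
      jointInfo (μ.map fun ω => ((fun i => x i ω), b ω)) := by
    have := Measure.isProbabilityMeasure_map (μ := μ) (hX.prodMk hb).aemeasurable
    rw [mutualInfo_eq_jointInfo hb hX, ← jointInfo_map_swap (μ.map fun ω => ((x · ω), b ω)),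
      Measure.map_map measurable_swap (hX.prodMk hb)]
    rfl
  have hTH : jointInfo T ≤ N * C := by
    rw [← hC, shannonEntropy]
    refine (jointInfo_le_entropy T).trans_eq ?_
    rw [hT, Measure.snd_map_prodMk hY]
  obtain ⟨S', hS'p, hS'fst, hS'y, hS'x⟩ : ∃ S' : Measure (𝒴 × ℝ), IsProbabilityMeasure S' ∧
      S'.fst = q ∧ N * jointInfo S' ≤ ∑ i, jointInfo (S i) ∧
      ∑ i, jointInfo ((R ∥ₖ Kernel.id) ∘ₘ S i) ≤
        N * jointInfo ((R ∥ₖ Kernel.id) ∘ₘ S') := by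
    rcases eq_or_ne N 0 with rfl | hN
    -- For `N = 0` there is no letter to average over, but all sums vanish and any auxiliary law
    -- with input marginal `q` will do.
    · exact ⟨q.prod (Measure.dirac 0), inferInstance, by simp, by simp, by simp⟩
    · obtain ⟨S', h1, h2, h3, h4⟩ := exists_timeSharing hN q R S hSfst
      exact ⟨S', h1, h2, h3.le, h4.ge⟩
  have hmν : Measurable fun w : (𝒴 × ℝ) × 𝒳 => (w.2, (w.1.1, w.1.2)) := by fun_prop
  -- Draw `(y*, z*)` from `S'`, then `x*` from the backward channel given `y*` only; this forces
  -- both the law `P` and the Markov property.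
  set ν := (S' ⊗ₘ R.prodMkRight ℝ).map fun w => (w.2, (w.1.1, w.1.2)) with hν
  have hνp : IsProbabilityMeasure ν := Measure.isProbabilityMeasure_map hmν.aemeasurable
  have hνyx : ν.map (fun ω => (ω.2.1, ω.1)) = q ⊗ₘ R := by
    rw [hν, Measure.map_map (by fun_prop) hmν, ← hS'fst, ← map_compProd_prodMkRight_fst]
    rfl
  have hνxz : ν.map (fun ω => (ω.1, ω.2.2)) = (R ∥ₖ Kernel.id) ∘ₘ S' := by
    rw [hν, Measure.map_map (by fun_prop) hmν, ← map_compProd_prodMkRight]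
    rfl
  have hνyz : ν.map (fun ω => (ω.2.1, ω.2.2)) = S' := by
    rw [hν, Measure.map_map (by fun_prop) hmν]
    exact Measure.fst_compProd S' (R.prodMkRight ℝ)
  have hνy : ν.map (fun ω => ω.2.1) = q := by
    rw [← Measure.fst_map_prodMk (Y := fun ω : 𝒳 × 𝒴 × ℝ => ω.1) (by fun_prop), hνyx,
      Measure.fst_compProd]
  refine ⟨ν, hνp, ?_, ?_, ?_, ?_⟩
  · have h : ν.map (fun ω => (ω.1, ω.2.1)) = (q ⊗ₘ R).map Prod.swap := by
      rw [← hνyx, Measure.map_map measurable_swap (by fun_prop)]; rfl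
    rw [h, hqR, Measure.map_map measurable_swap measurable_swap, Prod.swap_swap_eq,
      Measure.map_id]
  · refine CondIndepFun.symm ?_
    refine (condIndepFun_iff_condDistrib_prod_ae_eq_prodMkRight (f := fun ω : 𝒳 × 𝒴 × ℝ => ω.1)
      (g := fun ω => ω.2.2) (k := fun ω => ω.2.1) (by fun_prop) (by fun_prop) (by fun_prop)).2 ?_
    have h1 : condDistrib (fun ω : 𝒳 × 𝒴 × ℝ => ω.1) (fun ω => (ω.2.1, ω.2.2)) ν
        =ᵐ[ν.map fun ω => (ω.2.1, ω.2.2)] R.prodMkRight ℝ := by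
      refine condDistrib_ae_eq_of_measure_eq_compProd _ (by fun_prop) ?_
      rw [hνyz, hν, Measure.map_map (by fun_prop) hmν]
      exact Measure.map_id
    have h2 : condDistrib (fun ω : 𝒳 × 𝒴 × ℝ => ω.1) (fun ω => ω.2.1) ν =ᵐ[S'.fst] R := by
      rw [hS'fst, ← hνy]
      refine condDistrib_ae_eq_of_measure_eq_compProd _ (by fun_prop) ?_
      rw [hνyx, hνy]
    have h3 : (condDistrib (fun ω : 𝒳 × 𝒴 × ℝ => ω.1) (fun ω => ω.2.1) ν).prodMkRight ℝ
        =ᵐ[ν.map fun ω => (ω.2.1, ω.2.2)] R.prodMkRight ℝ := by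
      rw [hνyz]
      exact ae_of_ae_map measurable_fst.aemeasurable h2
    exact h1.trans h3.symm
  · rw [hbx, mutualInfo_eq_jointInfo (by fun_prop) (by fun_prop), hνxz]
    exact hSx.trans hS'x
  · rw [mutualInfo_eq_jointInfo (by fun_prop) (by fun_prop), hνyz]
    exact (hS'y.trans hSy).trans hTH
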